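/- Let $M$ be a smooth manifold of dimension $2n+1$ (without boundary, not necessarily compact) with an almost contact metric structure $(J,\xi,\eta,g)$: $g$ is a smooth Riemannian metric, $J$ a smooth tensor field of type $(1,1)$, $\xi$ a smooth vector field (the Reeb field) and $\eta$ a smooth 1-form such that $$J^2=-I+\eta\otimes\xi,\qquad \eta(\xi)=1,\qquad g(JX,JY)=g(X,Y)-\eta(X)\eta(Y)$$ for all vector fields $X,Y$. Put $\omega(X,Y)=g(JX,Y)$ and let $[J,J](X,Y)=J^2[X,Y]+[JX,JY]-J[JX,Y]-J[X,JY]$ be the Nijenhuis torsion of $J$. Suppose that the structure is co-Kähler, i.e. $$[J,J]+2\,d\eta\otimes\xi=0\quad\text{and}\quad d\omega=0=d\eta .$$ Then: 1. $\xi$ is a Killing vector field: $(L_\xi g)(X,Y)=\xi\, g(X,Y)-g([\xi,X],Y)-g(X,[\xi,Y])=0$ for all smooth vector fields $X,Y$; 2. $\xi$ is parallel: $\nabla_v\xi=0$ for every tangent vector $v$, where $\nabla$ is the Levi-Civita connection of $g$; 3. the 1-form $\eta$ is harmonic, i.e. closed and co-closed: $d\eta=0$ and $\delta\eta=-\sum_i(\nabla_{e_i}\eta)(e_i)=0$,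 where $(e_i)$ is an orthonormal basis of the tangent space at the point considered. -/

import Mathlib

open Bundle VectorField Module
open scoped Manifold ContDiff

noncomputable section

namespace CoKahler

variable {E : Type*} [NormedAddCommGroup E] [NormedSpace ℝ E]
  {H : Type*} [TopologicalSpace H] (I : ModelWithCorners ℝ E H)
  {M : Type*} [TopologicalSpace M] [ChartedSpace H M]

/-! ### Smooth vector fields, 1-forms and (1,1)-tensors -/

/-- Smooth vector fields on `M`. -/
def SmoothField [IsManifold I ∞ M] (X : Π x : M, TangentSpace I x) : Prop :=
  ContMDiff I (I.prod 𝓘(ℝ, E)) ∞ (fun x ↦ TotalSpace.mk' E (E := TangentSpace I) x (X x))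

/-- Smooth 1-forms on `M`. -/
def SmoothOneForm [IsManifold I ∞ M] (α : Π x : M, TangentSpace I x →L[ℝ] ℝ) : Prop :=
  ContMDiff I (I.prod 𝓘(ℝ, E →L[ℝ] ℝ)) ∞
    (fun x ↦ TotalSpace.mk' (E →L[ℝ] ℝ) (E := fun x : M ↦ TangentSpace I x →L[ℝ] ℝ) x (α x))

/-- Smooth tensors of type (1,1) on `M`, seen as fields of endomorphisms. -/
def SmoothEndo [IsManifold I ∞ M]
    (J : Π x : M, TangentSpace I x →L[ℝ] TangentSpace I x) : Prop :=
  ContMDiff I (I.prod 𝓘(ℝ, E →L[ℝ] E)) ∞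
    (fun x ↦ TotalSpace.mk' (E →L[ℝ] E)
      (E := fun x : M ↦ TangentSpace I x →L[ℝ] TangentSpace I x) x (J x))

/-- The derivative `X f` of the function `f` along the vector field `X`. -/
def dirDeriv (X : Π x : M, TangentSpace I x) (f : M → ℝ) (x : M) : ℝ :=
  mvfderiv I f x (X x)

/-! ### Exterior derivatives of 1-forms and 2-forms -/

/-- `dα(X,Y) = X α(Y) - Y α(X) - α([X,Y])`. -/
def extDerivOne (α : Π x : M, TangentSpace I x →L[ℝ] ℝ)
    (X Y : Π x : M, TangentSpace I x) (x : M) : ℝ :=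
  dirDeriv I X (fun y ↦ α y (Y y)) x - dirDeriv I Y (fun y ↦ α y (X y)) x
    - α x (mlieBracket I X Y x)

/-- `dΩ(X,Y,Z) = X Ω(Y,Z) - Y Ω(X,Z) + Z Ω(X,Y) - Ω([X,Y],Z) + Ω([X,Z],Y) - Ω([Y,Z],X)`. -/
def extDerivTwo (Ω : Π x : M, TangentSpace I x →L[ℝ] TangentSpace I x →L[ℝ] ℝ)
    (X Y Z : Π x : M, TangentSpace I x) (x : M) : ℝ :=
  dirDeriv I X (fun y ↦ Ω y (Y y) (Z y)) x - dirDeriv I Y (fun y ↦ Ω y (X y) (Z y)) x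
    + dirDeriv I Z (fun y ↦ Ω y (X y) (Y y)) x
    - Ω x (mlieBracket I X Y x) (Z x) + Ω x (mlieBracket I X Z x) (Y x)
    - Ω x (mlieBracket I Y Z x) (X x)

/-- `dα = 0`. -/
def IsClosedOne [IsManifold I ∞ M] (α : Π x : M, TangentSpace I x →L[ℝ] ℝ) : Prop :=
  ∀ X Y : Π x : M, TangentSpace I x, SmoothField I X → SmoothField I Y →
    ∀ x, extDerivOne I α X Y x = 0

/-- `dΩ = 0`. -/
def IsClosedTwo [IsManifold I ∞ M]
    (Ω : Π x : M, TangentSpace I x →L[ℝ] TangentSpace I x →L[ℝ] ℝ) : Prop :=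
  ∀ X Y Z : Π x : M, TangentSpace I x, SmoothField I X → SmoothField I Y → SmoothField I Z →
    ∀ x, extDerivTwo I Ω X Y Z x = 0

/-- The Nijenhuis torsion `[J,J](X,Y) = J²[X,Y] + [JX,JY] - J[JX,Y] - J[X,JY]`. -/
def nijenhuis (J : Π x : M, TangentSpace I x →L[ℝ] TangentSpace I x)
    (X Y : Π x : M, TangentSpace I x) (x : M) : TangentSpace I x :=
  J x (J x (mlieBracket I X Y x))
    + mlieBracket I (fun y ↦ J y (X y)) (fun y ↦ J y (Y y)) x
    - J x (mlieBracket I (fun y ↦ J y (X y)) Y x)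
    - J x (mlieBracket I X (fun y ↦ J y (Y y)) x)

/-! ### The Levi-Civita connection -/


lemma dirDeriv_smul_left (f : M → ℝ) (X : Π x : M, TangentSpace I x) (h : M → ℝ) (x : M) :
    dirDeriv I (f • X) h x = f x * dirDeriv I X h x := by
  simp [dirDeriv]

lemma dirDeriv_add_left (X X' : Π x : M, TangentSpace I x) (h : M → ℝ) (x : M) :
    dirDeriv I (X + X') h x = dirDeriv I X h x + dirDeriv I X' h x := by
  simp [dirDeriv]

lemma dirDeriv_mul (X : Π x : M, TangentSpace I x) {f h : M → ℝ} {x : M}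
    (hf : MDiffAt f x) (hh : MDiffAt h x) :
    dirDeriv I X (f * h) x = f x * dirDeriv I X h x + dirDeriv I X f x * h x := by
  simp [dirDeriv, mvfderiv_mul hf hh]
  ring

lemma dirDeriv_add (X : Π x : M, TangentSpace I x) {f h : M → ℝ} {x : M}
    (hf : MDiffAt f x) (hh : MDiffAt h x) :
    dirDeriv I X (f + h) x = dirDeriv I X f x + dirDeriv I X h x := by
  simp [dirDeriv, mvfderiv_add hf hh]

section Metric

/- The Riemannian metric `g` is the inner product carried by the tangent spaces. -/
variable [RiemannianBundle (fun x : M ↦ TangentSpace I x)]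

/-- The function `x ↦ g(X,Y)` of `x`. -/
def metric (X Y : Π x : M, TangentSpace I x) (x : M) : ℝ := inner ℝ (X x) (Y x)

/-- The right-hand side of Koszul's formula, i.e. `2 g(∇_X Y, Z)`. -/
def koszul (X Y Z : Π x : M, TangentSpace I x) (x : M) : ℝ :=
  dirDeriv I X (metric I Y Z) x + dirDeriv I Y (metric I X Z) x - dirDeriv I Z (metric I X Y) x
    + metric I (mlieBracket I X Y) Z x + metric I (mlieBracket I Z X) Y x
    - metric I (mlieBracket I Y Z) X x

lemma metric_comm (X Y : Π x : M, TangentSpace I x) : metric I X Y = metric I Y X := by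
  ext x; exact real_inner_comm _ _

lemma metric_smul_left (f : M → ℝ) (X Y : Π x : M, TangentSpace I x) :
    metric I (f • X) Y = f * metric I X Y := by
  ext x; simp [metric, inner_smul_left]

lemma metric_smul_right (f : M → ℝ) (X Y : Π x : M, TangentSpace I x) :
    metric I X (f • Y) = f * metric I X Y := by
  ext x; simp [metric, inner_smul_right]

lemma metric_add_left (X X' Y : Π x : M, TangentSpace I x) :
    metric I (X + X') Y = metric I X Y + metric I X' Y := by
  ext x; simp [metric, inner_add_left]

lemma metric_add_right (X Y Y' : Π x : M, TangentSpace I x) :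
    metric I X (Y + Y') = metric I X Y + metric I X Y' := by
  ext x; simp [metric, inner_add_right]

variable [IsManifold I ∞ M]
  [IsContMDiffRiemannianBundle I ∞ E (fun x : M ↦ TangentSpace I x)]

lemma mdiff_metric {X Y : Π x : M, TangentSpace I x} {x : M}
    (hX : MDiffAt (T% X) x) (hY : MDiffAt (T% Y) x) : MDiffAt (metric I X Y) x :=
  MDifferentiableAt.inner_bundle (IB := I) (E := fun x : M ↦ TangentSpace I x) (F := E)
    (b := id) hX hY

variable [FiniteDimensional ℝ E]

lemma koszul_smul_right (X Y : Π x : M, TangentSpace I x) {Z : Π x : M, TangentSpace I x}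
    {f : M → ℝ} {x : M} (hX : MDiffAt (T% X) x) (hY : MDiffAt (T% Y) x) (hZ : MDiffAt (T% Z) x)
    (hf : MDiffAt f x) : koszul I X Y (f • Z) x = f x * koszul I X Y Z x := by
  have := FiniteDimensional.complete ℝ E
  simp only [koszul, metric_smul_right, dirDeriv_smul_left, dirDeriv_mul I X hf (mdiff_metric I hY hZ),
    dirDeriv_mul I Y hf (mdiff_metric I hX hZ)]
  simp only [metric, mlieBracket_smul_left hf hZ, mlieBracket_smul_right hf hZ, dirDeriv,
    inner_add_left, inner_smul_left]
  simp [metric, real_inner_comm]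
  ring

lemma koszul_add_right (X Y : Π x : M, TangentSpace I x) {Z Z' : Π x : M, TangentSpace I x}
    {x : M} (hX : MDiffAt (T% X) x) (hY : MDiffAt (T% Y) x) (hZ : MDiffAt (T% Z) x)
    (hZ' : MDiffAt (T% Z') x) :
    koszul I X Y (Z + Z') x = koszul I X Y Z x + koszul I X Y Z' x := by
  have := FiniteDimensional.complete ℝ E
  simp only [koszul, metric_add_right, dirDeriv_add_left,
    dirDeriv_add I X (mdiff_metric I hY hZ) (mdiff_metric I hY hZ'),
    dirDeriv_add I Y (mdiff_metric I hX hZ) (mdiff_metric I hX hZ')]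
  simp only [metric, mlieBracket_add_left hZ hZ', mlieBracket_add_right hZ hZ',
    inner_add_left, Pi.add_apply]
  ring

lemma koszul_smul_left {X : Π x : M, TangentSpace I x} (Y Z : Π x : M, TangentSpace I x)
    {f : M → ℝ} {x : M} (hX : MDiffAt (T% X) x) (hY : MDiffAt (T% Y) x) (hZ : MDiffAt (T% Z) x)
    (hf : MDiffAt f x) : koszul I (f • X) Y Z x = f x * koszul I X Y Z x := by
  have := FiniteDimensional.complete ℝ E
  simp only [koszul, metric_smul_left, dirDeriv_smul_left, dirDeriv_mul I Y hf (mdiff_metric I hX hZ),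
    dirDeriv_mul I Z hf (mdiff_metric I hX hY)]
  simp only [metric, mlieBracket_smul_left hf hX, mlieBracket_smul_right hf hX, dirDeriv,
    inner_add_left, inner_smul_left]
  simp [inner_smul_right, real_inner_comm]
  ring

lemma koszul_add_left {X X' : Π x : M, TangentSpace I x} (Y Z : Π x : M, TangentSpace I x)
    {x : M} (hX : MDiffAt (T% X) x) (hX' : MDiffAt (T% X') x) (hY : MDiffAt (T% Y) x)
    (hZ : MDiffAt (T% Z) x) :
    koszul I (X + X') Y Z x = koszul I X Y Z x + koszul I X' Y Z x := by
  have := FiniteDimensional.complete ℝ E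
  simp only [koszul, metric_add_left, dirDeriv_add_left,
    dirDeriv_add I Y (mdiff_metric I hX hZ) (mdiff_metric I hX' hZ),
    dirDeriv_add I Z (mdiff_metric I hX hY) (mdiff_metric I hX' hY)]
  simp only [metric, mlieBracket_add_left hX hX', mlieBracket_add_right hX hX',
    inner_add_left, Pi.add_apply, inner_add_right]
  ring

lemma koszul_smul_mid (X Z : Π x : M, TangentSpace I x) {Y : Π x : M, TangentSpace I x}
    {f : M → ℝ} {x : M} (hX : MDiffAt (T% X) x) (hY : MDiffAt (T% Y) x) (hZ : MDiffAt (T% Z) x)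
    (hf : MDiffAt f x) : koszul I X (f • Y) Z x =
      f x * koszul I X Y Z x + 2 * (dirDeriv I X f x * metric I Y Z x) := by
  have := FiniteDimensional.complete ℝ E
  simp only [koszul, metric_smul_left, metric_smul_right, dirDeriv_smul_left,
    dirDeriv_mul I X hf (mdiff_metric I hY hZ), dirDeriv_mul I Z hf (mdiff_metric I hX hY)]
  simp only [metric, mlieBracket_smul_left hf hY, mlieBracket_smul_right hf hY, dirDeriv,
    inner_add_left, inner_smul_left]
  simp [metric, real_inner_comm]
  ring

lemma koszul_add_mid (X Z : Π x : M, TangentSpace I x) {Y Y' : Π x : M, TangentSpace I x}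
    {x : M} (hX : MDiffAt (T% X) x) (hY : MDiffAt (T% Y) x) (hY' : MDiffAt (T% Y') x)
    (hZ : MDiffAt (T% Z) x) :
    koszul I X (Y + Y') Z x = koszul I X Y Z x + koszul I X Y' Z x := by
  have := FiniteDimensional.complete ℝ E
  simp only [koszul, metric_add_left, metric_add_right, dirDeriv_add_left,
    dirDeriv_add I X (mdiff_metric I hY hZ) (mdiff_metric I hY' hZ),
    dirDeriv_add I Z (mdiff_metric I hX hY) (mdiff_metric I hX hY')]
  simp only [metric, mlieBracket_add_left hY hY', mlieBracket_add_right hY hY',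
    inner_add_left, Pi.add_apply]
  ring

/-- The bilinear form `(X,Z) ↦ 2 g(∇_X Y, Z)` on the tangent space at `x`, for a vector field `Y`
that is differentiable at `x`. -/
def koszulForm (Y : Π x : M, TangentSpace I x) (x : M) (hY : MDiffAt (T% Y) x) :
    TangentSpace I x →L[ℝ] TangentSpace I x →L[ℝ] ℝ :=
  TensorialAt.mkHom₂ (I := I) (F := E) (F' := E) (fun X Z ↦ koszul I X Y Z x) x
    (fun Z hZ ↦ ⟨fun hf hX ↦ koszul_smul_left I Y Z hX hY hZ hf,
      fun hX hX' ↦ koszul_add_left I Y Z hX hX' hY hZ⟩)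
    (fun X hX ↦ ⟨fun hf hZ ↦ koszul_smul_right I X Y hX hY hZ hf,
      fun hZ hZ' ↦ koszul_add_right I X Y hX hY hZ hZ'⟩)

lemma koszulForm_apply {X Y Z : Π x : M, TangentSpace I x} {x : M} (hX : MDiffAt (T% X) x)
    (hY : MDiffAt (T% Y) x) (hZ : MDiffAt (T% Z) x) :
    koszulForm I Y x hY (X x) (Z x) = koszul I X Y Z x :=
  TensorialAt.mkHom₂_apply _ _ hX hZ

instance (x : M) : FiniteDimensional ℝ (TangentSpace I x) :=
  inferInstanceAs (FiniteDimensional ℝ E)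

/-- The orthonormal basis of the tangent space at `x` used to raise indices and take traces. -/
def frame (x : M) : OrthonormalBasis (Fin (finrank ℝ (TangentSpace I x))) ℝ (TangentSpace I x) :=
  stdOrthonormalBasis ℝ (TangentSpace I x)

open Classical in
/-- The Levi-Civita connection on vector fields: `X ↦ ∇_X Y` at the point `x` is the endomorphism
of the tangent space determined by Koszul's formula if `Y` is differentiable at `x`
(otherwise it is `0`). -/
def leviCivitaFun (Y : Π x : M, TangentSpace I x) (x : M) :
    TangentSpace I x →L[ℝ] TangentSpace I x :=
  if hY : MDiffAt (T% Y) x then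
    (1 / 2 : ℝ) • ∑ i, ((koszulForm I Y x hY).flip (frame I x i)).smulRight (frame I x i)
  else 0

/-- Koszul's formula. -/
lemma two_inner_leviCivitaFun {X Y Z : Π x : M, TangentSpace I x} {x : M}
    (hX : MDiffAt (T% X) x) (hY : MDiffAt (T% Y) x) (hZ : MDiffAt (T% Z) x) :
    2 * inner ℝ (leviCivitaFun I Y x (X x)) (Z x) = koszul I X Y Z x := by
  have h : Z x = ∑ i, inner ℝ (frame I x i) (Z x) • frame I x i :=
    ((frame I x).sum_repr' (Z x)).symm
  rw [← koszulForm_apply I hX hY hZ]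
  conv_rhs => rw [h]
  simp [leviCivitaFun, hY, inner_smul_left, sum_inner, mul_comm]

lemma leviCivitaFun_eq {X Y : Π x : M, TangentSpace I x} {x : M}
    (hX : MDiffAt (T% X) x) (hY : MDiffAt (T% Y) x) (w : TangentSpace I x)
    (h : ∀ Z : Π x : M, TangentSpace I x, MDiffAt (T% Z) x →
      2 * inner ℝ w (Z x) = koszul I X Y Z x) :
    leviCivitaFun I Y x (X x) = w := by
  refine ext_inner_right ℝ fun z ↦ ?_
  have hz := FiberBundle.mdifferentiableAt_extend I E (V := TangentSpace I) z
  have h1 := two_inner_leviCivitaFun I hX hY hz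
  rw [← h _ hz] at h1
  simpa using h1

/-- The Levi-Civita connection of the Riemannian manifold `M`. -/
def leviCivita : CovariantDerivative I E (fun x : M ↦ TangentSpace I x) where
  toFun := leviCivitaFun I
  isCovariantDerivativeOnUniv :=
    { add := fun {Y Y' x} hY hY' _ ↦ by
        ext v
        have hv := FiberBundle.mdifferentiableAt_extend I E (V := TangentSpace I) v
        have := leviCivitaFun_eq I hv (mdifferentiableAt_add_section hY hY')
          (leviCivitaFun I Y x v + leviCivitaFun I Y' x v) fun Z hZ ↦ by
            have h1 := two_inner_leviCivitaFun I hv hY hZ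
            have h2 := two_inner_leviCivitaFun I hv hY' hZ
            rw [koszul_add_mid I _ Z hv hY hY' hZ, ← h1, ← h2]
            simp [inner_add_left, mul_add]
        simpa using this
      leibniz := fun {Y f x} hY hf _ ↦ by
        ext v
        have hv := FiberBundle.mdifferentiableAt_extend I E (V := TangentSpace I) v
        have := leviCivitaFun_eq I hv (hf.smul_section hY)
          (f x • leviCivitaFun I Y x v + (mvfderiv I f x v) • Y x) fun Z hZ ↦ by
            have h1 := two_inner_leviCivitaFun I hv hY hZ
            rw [koszul_smul_mid I _ Z hv hY hZ hf, ← h1]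
            simp [inner_add_left, inner_smul_left, dirDeriv, metric]
            ring
        simpa using this }

/-- The Levi-Civita connection is torsion-free. -/
lemma leviCivita_torsion {X Y : Π x : M, TangentSpace I x} {x : M}
    (hX : MDiffAt (T% X) x) (hY : MDiffAt (T% Y) x) :
    leviCivita I Y x (X x) - leviCivita I X x (Y x) = mlieBracket I X Y x := by
  refine ext_inner_right ℝ fun z ↦ ?_
  have hz := FiberBundle.mdifferentiableAt_extend I E (V := TangentSpace I) z
  have h1 := two_inner_leviCivitaFun I hX hY hz
  have h2 := two_inner_leviCivitaFun I hY hX hz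
  simp only [koszul, metric_comm I Y X, mlieBracket_swap (V := Y) (W := X),
    mlieBracket_swap (V := X) (W := FiberBundle.extend E z),
    mlieBracket_swap (V := Y) (W := FiberBundle.extend E z)] at h1 h2
  simp only [metric, Pi.neg_apply, inner_neg_left, FiberBundle.extend_apply_self] at h1 h2
  rw [inner_sub_left]
  simp only [leviCivita]
  linarith

/-- The Levi-Civita connection is compatible with the metric. -/
lemma leviCivita_metric {X Y Z : Π x : M, TangentSpace I x} {x : M}
    (hX : MDiffAt (T% X) x) (hY : MDiffAt (T% Y) x) (hZ : MDiffAt (T% Z) x) :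
    dirDeriv I X (metric I Y Z) x =
      inner ℝ (leviCivita I Y x (X x)) (Z x) + inner ℝ (Y x) (leviCivita I Z x (X x)) := by
  have h1 := two_inner_leviCivitaFun I hX hY hZ
  have h2 := two_inner_leviCivitaFun I hX hZ hY
  simp only [koszul, metric_comm I Z Y,
    mlieBracket_swap (V := Y) (W := X), mlieBracket_swap (V := X) (W := Z),
    mlieBracket_swap (V := Y) (W := Z)] at h1 h2
  simp only [metric, Pi.neg_apply, inner_neg_left] at h1 h2
  rw [real_inner_comm _ (Y x)]
  simp only [leviCivita]
  linarith

/-! ### Killing and parallel vector fields, harmonic 1-forms -/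

/-- The Lie derivative of the metric,
`(L_V g)(X,Y) = V g(X,Y) - g([V,X],Y) - g(X,[V,Y])`. -/
def lieDerivMetric (V X Y : Π x : M, TangentSpace I x) (x : M) : ℝ :=
  dirDeriv I V (metric I X Y) x - metric I (mlieBracket I V X) Y x
    - metric I X (mlieBracket I V Y) x

/-- `V` is a Killing vector field: `L_V g = 0`. -/
def IsKilling (V : Π x : M, TangentSpace I x) : Prop :=
  ∀ X Y : Π x : M, TangentSpace I x, SmoothField I X → SmoothField I Y →
    ∀ x, lieDerivMetric I V X Y x = 0

/-- `V` is parallel for the Levi-Civita connection: `∇_v V = 0` for every tangent vector `v`. -/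
def IsParallel (V : Π x : M, TangentSpace I x) : Prop :=
  ∀ (x : M) (v : TangentSpace I x), leviCivita I V x v = 0

/-- The covariant derivative of a 1-form, `(∇_X α)(Y) = X α(Y) - α(∇_X Y)`. -/
def covDerivOne (α : Π x : M, TangentSpace I x →L[ℝ] ℝ)
    (X Y : Π x : M, TangentSpace I x) (x : M) : ℝ :=
  dirDeriv I X (fun y ↦ α y (Y y)) x - α x (leviCivita I Y x (X x))

/-- The codifferential of a 1-form, `δα = - ∑ᵢ (∇_{eᵢ} α)(eᵢ)` for an orthonormal basis `(eᵢ)` of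
the tangent space at `x`. In order to evaluate `∇ α`, the vectors `eᵢ` are extended to vector fields
that are smooth near `x`. -/
def codifferential (α : Π x : M, TangentSpace I x →L[ℝ] ℝ) (x : M) : ℝ :=
  - ∑ i, covDerivOne I α (FiberBundle.extend E (frame I x i)) (FiberBundle.extend E (frame I x i)) x

/-- `α` is a harmonic 1-form: `dα = 0` and `δα = 0`. -/
def IsHarmonic (α : Π x : M, TangentSpace I x →L[ℝ] ℝ) : Prop :=
  IsClosedOne I α ∧ ∀ x, codifferential I α x = 0

end Metric

/-! ### Almost contact metric structures and co-Kähler structures -/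

/-- An almost contact metric structure `(J,ξ,η,g)` on `M`, where the Riemannian metric `g` is the
inner product carried by the tangent spaces. -/
structure AlmostContactMetric (M : Type*) [TopologicalSpace M] [ChartedSpace H M]
    [IsManifold I ∞ M] [RiemannianBundle (fun x : M ↦ TangentSpace I x)] where
  /-- The tensor field of type (1,1). -/
  J : Π x : M, TangentSpace I x →L[ℝ] TangentSpace I x
  /-- The Reeb vector field. -/
  ξ : Π x : M, TangentSpace I x
  /-- The 1-form. -/
  η : Π x : M, TangentSpace I x →L[ℝ] ℝ
  smooth_J : SmoothEndo I J
  smooth_ξ : SmoothField I ξ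
  smooth_η : SmoothOneForm I η
  J_sq : ∀ (x : M) (v : TangentSpace I x), J x (J x v) = -v + η x v • ξ x
  η_ξ : ∀ x : M, η x (ξ x) = 1
  inner_J : ∀ (x : M) (v w : TangentSpace I x),
    inner ℝ (J x v) (J x w) = inner ℝ v w - η x v * η x w

namespace AlmostContactMetric

variable {I} [IsManifold I ∞ M] [RiemannianBundle (fun x : M ↦ TangentSpace I x)]

/-- The fundamental 2-form `Ω(X,Y) = g(JX,Y)`. -/
def fundamentalForm (S : AlmostContactMetric I M) (x : M) :
    TangentSpace I x →L[ℝ] TangentSpace I x →L[ℝ] ℝ :=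
  (innerSL ℝ).comp (S.J x)

/-- The structure is co-Kähler: `[J,J] + 2 dη ⊗ ξ = 0` and `dΩ = 0 = dη`. -/
structure IsCoKahler (S : AlmostContactMetric I M) : Prop where
  normal : ∀ X Y : Π x : M, TangentSpace I x, SmoothField I X → SmoothField I Y →
    ∀ x, nijenhuis I S.J X Y x + (2 * extDerivOne I S.η X Y x) • S.ξ x = 0
  closed_fundamentalForm : IsClosedTwo I S.fundamentalForm
  closed_η : IsClosedOne I S.η

end AlmostContactMetric

end CoKahler

end

namespace CoKahler

/-! ### Global smooth fields through a given tangent vector. -/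

section Extension

variable {E : Type*} [NormedAddCommGroup E] [NormedSpace ℝ E]
  {H : Type*} [TopologicalSpace H] (I : ModelWithCorners ℝ E H)
  {M : Type*} [TopologicalSpace M] [ChartedSpace H M] [IsManifold I ∞ M]

/-! Everything follows from the Killing property. Since Ω(X,JY) = g(X,Y) - η(X)η(Y), the metric can
be differentiated along ξ by differentiating Ω and η. As Jξ = 0, the equation dΩ(ξ,X,JY) = 0
expresses ξ Ω(X,JY) through Ω([ξ,X],JY) and Ω([ξ,JY],X). Normality gives J[ξ,JY] = J²[ξ,Y]
(`J_mlieBracket_ξ_J`), and dη = 0 gives ξ η(X) = η([ξ,X]) (`dirDeriv_ξ_η`). The η-terms then cancel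
and L_ξ g = 0 remains.

Because η = g(·,ξ), Koszul's formula splits ∇ξ into a skew part dη and a symmetric part L_ξ g. Both
vanish, so ξ is parallel; hence ∇η = 0 and in particular δη = 0. -/

lemma SmoothField.mdifferentiableAt {X : Π x : M, TangentSpace I x} (hX : SmoothField I X)
    (x : M) : MDiffAt (T% X) x :=
  ContMDiffAt.mdifferentiableAt (hX x) (by simp)

/-- Every tangent vector is the value of a global smooth vector field. -/
lemma exists_smoothField_eq [FiniteDimensional ℝ E] [T2Space M] (x : M) (v : TangentSpace I x) :
    ∃ X : Π x : M, TangentSpace I x, SmoothField I X ∧ X x = v := by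
  obtain ⟨s, hs, hsm⟩ := FiberBundle.exists_contMDiffOn_extend (k := ∞) I E
    (V := fun x : M ↦ TangentSpace I x) v
  obtain ⟨f, -, hf⟩ := (SmoothBumpFunction.nhds_basis_tsupport (I := I) x).mem_iff.1
    (interior_mem_nhds.2 hs)
  refine ⟨(f : M → ℝ) • FiberBundle.extend E v, ?_, by simp⟩
  exact ContMDiffOn.smul_section_of_tsupport f.contMDiff.contMDiffOn isOpen_interior hf
    (hsm.mono interior_subset)

end Extension

/-! ### Algebra of almost contact metric structures. -/

namespace AlmostContactMetric

variable {E : Type*} [NormedAddCommGroup E] [NormedSpace ℝ E]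
  {H : Type*} [TopologicalSpace H] {I : ModelWithCorners ℝ E H}
  {M : Type*} [TopologicalSpace M] [ChartedSpace H M] [IsManifold I ∞ M]
  [RiemannianBundle (fun x : M ↦ TangentSpace I x)] (S : AlmostContactMetric I M)

lemma J_ξ (x : M) : S.J x (S.ξ x) = 0 := by
  have h2 : S.J x (S.J x (S.ξ x)) = 0 := by simp [S.J_sq, S.η_ξ]
  have h3 := S.J_sq x (S.J x (S.ξ x))
  rw [h2, map_zero, eq_comm, neg_add_eq_zero] at h3
  -- At this point Jξ = η(Jξ)ξ. Applying J and then η, with J²ξ = 0, shows that η(Jξ) squares to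
  -- zero.
  have h4 : S.η x (S.J x (S.ξ x)) * S.η x (S.J x (S.ξ x)) = 0 := by
    have h := congrArg (S.η x) (congrArg (S.J x) h3)
    rw [h2, map_smul, map_smul] at h
    simpa using h.symm
  rw [h3, mul_self_eq_zero.1 h4, zero_smul]

/-- Computing J³v as J²(Jv) and as J(J²v) leaves η(Jv)ξ = 0. -/
lemma η_J (x : M) (v : TangentSpace I x) : S.η x (S.J x v) = 0 := by
  have h := S.J_sq x (S.J x v)
  rw [S.J_sq x v, map_add, map_neg, map_smul, S.J_ξ, smul_zero, add_zero, left_eq_add] at h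
  simpa [S.η_ξ] using congrArg (S.η x) h

lemma inner_ξ_right (x : M) (v : TangentSpace I x) : inner ℝ v (S.ξ x) = S.η x v := by
  have h := S.inner_J x v (S.ξ x)
  rw [S.J_ξ, inner_zero_right, S.η_ξ] at h
  linarith

lemma inner_J_left (x : M) (v w : TangentSpace I x) :
    inner ℝ (S.J x v) w = -inner ℝ v (S.J x w) := by
  have h := S.inner_J x (S.J x v) w
  rw [S.J_sq, S.η_J, inner_add_left, inner_neg_left, inner_smul_left, real_inner_comm,
    real_inner_comm (S.J x w) (S.ξ x), S.inner_ξ_right, S.η_J] at h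
  simp only [mul_zero, add_zero, zero_mul, sub_zero] at h
  rw [← h, real_inner_comm]

lemma metric_ξ_right (X : Π x : M, TangentSpace I x) :
    metric I X S.ξ = fun x ↦ S.η x (X x) :=
  funext fun x ↦ S.inner_ξ_right x (X x)

lemma metric_ξ_left (X : Π x : M, TangentSpace I x) :
    metric I S.ξ X = fun x ↦ S.η x (X x) := by
  rw [metric_comm, metric_ξ_right]

lemma fundamentalForm_apply (x : M) (v w : TangentSpace I x) :
    S.fundamentalForm x v w = inner ℝ (S.J x v) w := rfl

lemma smoothField_J {X : Π x : M, TangentSpace I x} (hX : SmoothField I X) :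
    SmoothField I (fun x ↦ S.J x (X x)) :=
  ContMDiff.clm_bundle_apply S.smooth_J hX

/-- The Leibniz decomposition of `ξ g(X,Y)` along `g(X,Y) = Ω(X,JY) + η(X) η(Y)`. -/
lemma dirDeriv_metric [IsContMDiffRiemannianBundle I ∞ E (fun x : M ↦ TangentSpace I x)]
    [FiniteDimensional ℝ E]
    (V : Π x : M, TangentSpace I x)
    {X Y : Π x : M, TangentSpace I x} (hX : SmoothField I X) (hY : SmoothField I Y) (x : M) :
    dirDeriv I V (metric I X Y) x =
      dirDeriv I V (fun y ↦ S.fundamentalForm y (X y) (S.J y (Y y))) x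
        + S.η x (X x) * dirDeriv I V (fun y ↦ S.η y (Y y)) x
        + dirDeriv I V (fun y ↦ S.η y (X y)) x * S.η x (Y x) := by
  have hdX := hX.mdifferentiableAt I x
  have hdY := hY.mdifferentiableAt I x
  have hξ := S.smooth_ξ.mdifferentiableAt I x
  have hJ := mdiff_metric I ((S.smoothField_J hX).mdifferentiableAt I x)
    ((S.smoothField_J hY).mdifferentiableAt I x)
  -- The functions η(X) and η(Y) are handled as g(X,ξ) and g(Y,ξ), so their differentiability comes
  -- from that of the metric.
  have h1 := mdiff_metric I hdX hξ
  have h2 := mdiff_metric I hdY hξ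
  have h : metric I X Y = metric I (fun y ↦ S.J y (X y)) (fun y ↦ S.J y (Y y))
      + metric I X S.ξ * metric I Y S.ξ := by
    ext y
    simp [metric, S.inner_J, S.inner_ξ_right]
  rw [h, dirDeriv_add I V hJ (h1.mul h2), dirDeriv_mul I V h1 h2, metric_ξ_right, metric_ξ_right,
    add_assoc]
  rfl

/-! ### Consequences of the co-Kähler condition. -/

namespace IsCoKahler

variable {S}

/-- In dη(ξ,X) = 0 the term X η(ξ) drops out because η(ξ) is constant. -/
lemma dirDeriv_ξ_η (hS : S.IsCoKahler) {X : Π x : M, TangentSpace I x} (hX : SmoothField I X) (x : M) :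
    dirDeriv I S.ξ (fun y ↦ S.η y (X y)) x = S.η x (mlieBracket I S.ξ X x) := by
  have h := hS.closed_η S.ξ X S.smooth_ξ hX x
  have hc : dirDeriv I X (fun y ↦ S.η y (S.ξ y)) x = 0 := by
    simp [dirDeriv, S.η_ξ, mvfderiv_const]
  rw [extDerivOne, hc] at h
  linarith

/-- Since Jξ = 0, only J²[ξ,X] and J[ξ,JX] survive in the torsion, and the dη-term is zero. -/
lemma J_mlieBracket_ξ_J (hS : S.IsCoKahler) {X : Π x : M, TangentSpace I x} (hX : SmoothField I X) (x : M) :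
    S.J x (mlieBracket I S.ξ (fun y ↦ S.J y (X y)) x)
      = S.J x (S.J x (mlieBracket I S.ξ X x)) := by
  have h := hS.normal S.ξ X S.smooth_ξ hX x
  have hJξ : (fun y ↦ S.J y (S.ξ y)) = 0 := funext S.J_ξ
  rw [hS.closed_η S.ξ X S.smooth_ξ hX x, nijenhuis, hJξ] at h
  simp only [mlieBracket_zero_left, Pi.zero_apply, map_zero, add_zero, sub_zero, mul_zero,
    zero_smul] at h
  exact (sub_eq_zero.1 h).symm

variable [FiniteDimensional ℝ E]
  [IsContMDiffRiemannianBundle I ∞ E (fun x : M ↦ TangentSpace I x)]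

lemma isKilling (hS : S.IsCoKahler) : IsKilling I S.ξ := by
  intro X Y hX hY x
  -- The third argument is JY because Ω(·,JY) = g(J·,JY) recovers g up to η-terms.
  have hΩ := hS.closed_fundamentalForm S.ξ X (fun y ↦ S.J y (Y y)) S.smooth_ξ hX
    (S.smoothField_J hY) x
  have hskew : ∀ v : TangentSpace I x, inner ℝ (S.J x v) (S.ξ x) = 0 := fun v ↦ by
    rw [S.inner_ξ_right, S.η_J]
  have h0 : ∀ V : Π x : M, TangentSpace I x, dirDeriv I V (fun _ : M ↦ (0 : ℝ)) x = 0 :=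
    fun V ↦ by simp [dirDeriv, mvfderiv_const]
  -- This is the surviving term Ω([ξ,JY],X), the only one not of the form g(J·,J·). Normality moves
  -- J out of the bracket.
  have hJJ : inner ℝ (S.J x (mlieBracket I S.ξ (fun y ↦ S.J y (Y y)) x)) (X x)
      = -inner ℝ (X x) (mlieBracket I S.ξ Y x)
        + S.η x (mlieBracket I S.ξ Y x) * S.η x (X x) := by
    rw [hS.J_mlieBracket_ξ_J hY, S.J_sq, inner_add_left, inner_neg_left, inner_smul_left,
      real_inner_comm, real_inner_comm (X x) (S.ξ x), S.inner_ξ_right]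
    simp
  simp only [extDerivTwo, fundamentalForm_apply, S.J_ξ, inner_zero_left, h0, hskew, hJJ,
    S.inner_J] at hΩ
  rw [lieDerivMetric, S.dirDeriv_metric _ hX hY, hS.dirDeriv_ξ_η hX, hS.dirDeriv_ξ_η hY]
  simp only [fundamentalForm_apply, S.inner_J, metric] at hΩ ⊢
  linarith

/-- Koszul's formula for `ξ`: `2 g(∇_X ξ, Z) = dη(X,Z) + (L_ξ g)(X,Z)`. -/
lemma isParallel (hS : S.IsCoKahler) [T2Space M] : IsParallel I S.ξ := by
  intro x v
  obtain ⟨X, hX, rfl⟩ := exists_smoothField_eq I x v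
  refine ext_inner_right ℝ fun z ↦ ?_
  obtain ⟨Z, hZ, rfl⟩ := exists_smoothField_eq I x z
  have hK := two_inner_leviCivitaFun I (hX.mdifferentiableAt I x)
    (S.smooth_ξ.mdifferentiableAt I x) (hZ.mdifferentiableAt I x)
  have hL := hS.isKilling X Z hX hZ x
  have hη := hS.closed_η X Z hX hZ x
  rw [koszul, S.metric_ξ_left, S.metric_ξ_right, S.metric_ξ_right, mlieBracket_swap (V := X),
    mlieBracket_swap (V := Z)] at hK
  simp only [lieDerivMetric, extDerivOne, metric, Pi.neg_apply, inner_neg_left, map_neg]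
    at hK hL hη
  rw [inner_zero_left]
  change inner ℝ (leviCivitaFun I S.ξ x (X x)) (Z x) = 0
  -- The terms X η(Z), Z η(X) and η([X,Z]) of Koszul's formula form dη(X,Z); the other three form
  -- (L_ξ g)(X,Z).
  linarith [real_inner_comm (X x) (mlieBracket I S.ξ Z x)]

lemma isHarmonic (hS : S.IsCoKahler) [T2Space M] : IsHarmonic I S.η := by
  refine ⟨hS.closed_η, fun x ↦ ?_⟩
  rw [codifferential, neg_eq_zero]
  refine Finset.sum_eq_zero fun i _ ↦ ?_
  have he := FiberBundle.mdifferentiableAt_extend I E (V := TangentSpace I) (frame I x i)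
  -- Each summand vanishes separately: differentiating η(e) = g(e,ξ) along e gives η(∇_e e), as ∇_e
  -- ξ = 0.
  have h := leviCivita_metric I he he (S.smooth_ξ.mdifferentiableAt I x)
  rw [hS.isParallel, inner_zero_right, add_zero, S.metric_ξ_right, S.inner_ξ_right] at h
  rw [covDerivOne, h, sub_self]

end IsCoKahler

end AlmostContactMetric

end CoKahler

theorem lemma1p2 {E : Type*} [NormedAddCommGroup E] [NormedSpace ℝ E] [FiniteDimensional ℝ E]
    {H : Type*} [TopologicalSpace H] (I : ModelWithCorners ℝ E H)
    {M : Type*} [TopologicalSpace M] [ChartedSpace H M] [T2Space M]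
    [IsManifold I ∞ M] [BoundarylessManifold I M]
    [RiemannianBundle (fun x : M ↦ TangentSpace I x)]
    [IsContMDiffRiemannianBundle I ∞ E (fun x : M ↦ TangentSpace I x)]
    (S : CoKahler.AlmostContactMetric I M) (hS : S.IsCoKahler) :
    CoKahler.IsKilling I S.ξ ∧ CoKahler.IsParallel I S.ξ ∧ CoKahler.IsHarmonic I S.η :=
  ⟨hS.isKilling, hS.isParallel, hS.isHarmonic⟩
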